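/- Consider words over the five-letter alphabet consisting of the burgers $H$, $C$ (a hamburger, respectively a cheeseburger, is produced and placed on top of a stack), the orders $h$, $c$ (the topmost hamburger, respectively the topmost cheeseburger, is removed from the stack) and the fresh order $F$ (the topmost burger, whatever its type, is removed from the stack). A word is read from left to right, starting with an empty stack. It is called perfect if every order is fulfilled by a burger that is already on the stack and the stack ends empty; a perfect word has order $n$ if it contains $n$ burgers and $n$ orders, i.e. has length $2n$. For integers $k,n\ge 0$ let $\Theta^k_n$ be the set of perfect words of order $n$ with exactly $k$ letters $F$, all of which are fulfilled by cheeseburgers. Theorem. For every fixed nonnegative integer $k$, $$\lim_{n\to\infty}\frac{|\Theta^k_n|}{n^k\,|\Theta^0_n|}=\frac{1}{k!\,4^k}.$$ -/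

import Mathlib

namespace HamburgerCheeseburger

/-- The two types of burgers. -/
inductive Burger
  | ham
  | cheese
  deriving DecidableEq

/-- The five-letter alphabet: two letters `produce b`, two letters `order b`, and `fresh`. -/
inductive Letter
  | produce (b : Burger)
  | order (b : Burger)
  | fresh
  deriving DecidableEq

/-- `true` exactly for the letters that produce a burger (the other three letters are orders). -/
def Letter.isBurger : Letter → Bool
  | .produce _ => true
  | _ => false

/-- The effect of one letter on the burger stack. The head of the list is the top of the stack.
The value is `none` if the letter is an order that cannot be fulfilled.
`List.erase` removes the first occurrence, that is, the topmost burger of the given type. -/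
def step : List Burger → Letter → Option (List Burger)
  | s, .produce b => some (b :: s)
  | s, .order b => if b ∈ s then some (s.erase b) else none
  | [], .fresh => none
  | _ :: s, .fresh => some s

/-- The stack after reading a word from left to right, starting from the stack `s`; the value is
`none` if some order in the word cannot be fulfilled. -/
def run : List Burger → List Letter → Option (List Burger)
  | s, [] => some s
  | s, a :: w => (step s a).bind fun s' => run s' w

/-- A perfect word: starting from the empty stack, every order is fulfilled by a burger that is
already on the stack, and the stack ends empty. -/
def IsPerfect (w : List Letter) : Prop :=
  run [] w = some []

/-- The word contains `n` burgers and `n` orders. -/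
def HasOrder (n : ℕ) (w : List Letter) : Prop :=
  w.countP (fun a => a.isBurger) = n ∧ w.countP (fun a => !a.isBurger) = n

/-- Every fresh order in `w` is fulfilled by a cheeseburger: just before each `fresh`,
the top of the stack is a cheeseburger. -/
def FreshFulfilledByCheese (w : List Letter) : Prop :=
  ∀ u v : List Letter, w = u ++ Letter.fresh :: v →
    ∃ s : List Burger, run [] u = some (Burger.cheese :: s)

/-- The perfect words of order `n` with exactly `k` fresh orders, which are all fulfilled by
cheeseburgers. -/
def Theta (k n : ℕ) : Set (List Letter) :=
  {w | IsPerfect w ∧ HasOrder n w ∧ w.count Letter.fresh = k ∧ FreshFulfilledByCheese w}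

theorem HasOrder.length_eq {n : ℕ} {w : List Letter} (h : HasOrder n w) : w.length = 2 * n := by
  have h1 := List.length_eq_countP_add_countP (fun a : Letter => a.isBurger) (l := w)
  obtain ⟨h2, h3⟩ := h
  simp only [Bool.not_eq_true, Bool.decide_eq_false] at h1
  omega

instance : Finite Letter :=
  Finite.of_injective
    (fun a : Letter => match a with
      | .produce .ham => (0 : Fin 5)
      | .produce .cheese => 1
      | .order .ham => 2
      | .order .cheese => 3
      | .fresh => 4)
    (by rintro (⟨_ | _⟩ | ⟨_ | _⟩ | _) (⟨_ | _⟩ | ⟨_ | _⟩ | _) <;> simp)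

/-- The sets `Theta k n` are finite, so their `Set.ncard` is the true cardinality. -/
theorem Theta_finite (k n : ℕ) : (Theta k n).Finite :=
  (List.finite_length_eq Letter (2 * n)).subset fun _ hw => hw.2.1.length_eq

end HamburgerCheeseburger

namespace HamburgerCheeseburger

open Finset Filter Topology

/-! With a cheeseburger on top, the letters `F` and `c` act alike. Hence a word of `Theta k n`
amounts to a perfect word without `F` and a choice of `k` among its `X` letters `c` read with cheese
on top, so `|Theta k n|` is the sum of `X.choose k` over `Theta 0 n` (`card_freshOnCheese`). It
remains to see that `X / n` concentrates at `1/4` on these perfect words.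

Classifying orders by the type ordered and the type on top gives four counts with sum `n`, one of
them `X`; lower bounds near `n/4` for all four therefore pin down each. In a uniform four-letter
word with impossible orders ignored, each count is superadditive under concatenation
(`orderCount_superadditive`) and has mean at least `1/8 - o(1)` per letter
(`exists_le_sum_orderCount`). A Chernoff bound over independent blocks makes a smaller rate
exponentially unlikely (`exists_card_lower_deviation_le`). Perfect words have proportion at least
`(n + 1)⁻⁶` among words of length `2n` (`pow_le_card_plainPerfect`), so the estimate survives
conditioning on perfection. -/

/-! ### Words over a finite alphabet -/

/-- The four letters other than `fresh`. -/
def plain : Finset Letter :=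
  {.produce .ham, .produce .cheese, .order .ham, .order .cheese}

/-- All five letters. -/
def letters : Finset Letter := insert .fresh plain

theorem sum_plain {M : Type*} [AddCommMonoid M] (f : Letter → M) :
    ∑ a ∈ plain, f a = f (.produce .ham) + (f (.produce .cheese) +
      (f (.order .ham) + f (.order .cheese))) := by
  simp [plain]

theorem sum_letters {M : Type*} [AddCommMonoid M] (f : Letter → M) :
    ∑ a ∈ letters, f a = f .fresh + ∑ a ∈ plain, f a := by
  rw [letters, sum_insert (by simp [plain])]

theorem mem_plain {a : Letter} : a ∈ plain ↔ a ≠ .fresh := by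
  rcases a with (⟨_ | _⟩ | ⟨_ | _⟩ | _) <;> simp [plain]

theorem mem_letters (a : Letter) : a ∈ letters := by
  rcases a with (⟨_ | _⟩ | ⟨_ | _⟩ | _) <;> simp [letters, plain]

/-- The words of length `L` over the alphabet `A`. -/
def words (A : Finset Letter) : ℕ → Finset (List Letter)
  | 0 => {[]}
  | L + 1 => (A ×ˢ words A L).image fun p => p.1 :: p.2

theorem mem_words {A : Finset Letter} {L : ℕ} {w : List Letter} :
    w ∈ words A L ↔ w.length = L ∧ ∀ a ∈ w, a ∈ A := by
  induction L generalizing w with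
  | zero =>
    rw [words, mem_singleton, List.length_eq_zero_iff]
    constructor
    · rintro rfl; simp
    · exact fun h => h.1
  | succ L ih =>
    rcases w with _ | ⟨a, w⟩
    · simp [words]
    · simp [words, ih]; tauto

theorem sum_words_zero {M : Type*} [AddCommMonoid M] (A : Finset Letter) (f : List Letter → M) :
    ∑ w ∈ words A 0, f w = f [] := by
  simp [words]

theorem sum_words_succ {M : Type*} [AddCommMonoid M] (A : Finset Letter) (L : ℕ)
    (f : List Letter → M) :
    ∑ w ∈ words A (L + 1), f w = ∑ a ∈ A, ∑ w ∈ words A L, f (a :: w) := by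
  rw [words, sum_image, sum_product]
  rintro ⟨a, u⟩ _ ⟨b, v⟩ _ h
  simpa using h

theorem sum_words_add {M : Type*} [AddCommMonoid M] (A : Finset Letter) (K L : ℕ)
    (f : List Letter → M) :
    ∑ w ∈ words A (K + L), f w = ∑ u ∈ words A K, ∑ v ∈ words A L, f (u ++ v) := by
  induction K generalizing f with
  | zero => simp [words]
  | succ K ih =>
    rw [Nat.add_right_comm, sum_words_succ, sum_words_succ]
    refine sum_congr rfl fun a _ => ?_
    rw [ih]
    simp

theorem sum_words_concat {M : Type*} [AddCommMonoid M] (A : Finset Letter) (L : ℕ)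
    (f : List Letter → M) :
    ∑ w ∈ words A (L + 1), f w = ∑ w ∈ words A L, ∑ a ∈ A, f (w ++ [a]) := by
  rw [sum_words_add]
  simp [sum_words_succ, sum_words_zero]

theorem card_words_plain (L : ℕ) : #(words plain L) = 4 ^ L := by
  induction L with
  | zero => simp [words]
  | succ L ih =>
    rw [card_eq_sum_ones, sum_words_succ]
    simp only [sum_plain, ← card_eq_sum_ones, ih]
    ring

/-! ### Runs -/

theorem run_append (s : List Burger) (u v : List Letter) :
    run s (u ++ v) = (run s u).bind fun t => run t v := by
  induction u generalizing s with
  | nil => rfl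
  | cons a u ih =>
    simp only [List.cons_append, run, Option.bind_assoc]
    exact congrArg _ (funext fun s' => ih s')

theorem run_cons_produce (s : List Burger) (b : Burger) (w : List Letter) :
    run s (.produce b :: w) = run (b :: s) w := rfl

theorem run_cons_order (s : List Burger) (b : Burger) (w : List Letter) :
    run s (.order b :: w) = if b ∈ s then run (s.erase b) w else none := by
  by_cases h : b ∈ s <;> simp [run, step, h]

/-- The stack after reading one letter, where orders that cannot be fulfilled are ignored. -/
def advance (s : List Burger) : Letter → List Burger
  | .produce b => b :: s
  | .order b => s.erase b
  | .fresh => s.tail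

theorem eq_advance_of_step {s t : List Burger} {a : Letter} (h : step s a = some t) :
    t = advance s a := by
  rcases a with b | b | _
  · simp_all [step, advance]
  · by_cases hb : b ∈ s <;> simp_all [step, advance]
  · rcases s with _ | ⟨c, s⟩ <;> simp_all [step, advance]

theorem run_cons_eq_some {s t : List Burger} {a : Letter} {w : List Letter} :
    run s (a :: w) = some t ↔ step s a = some (advance s a) ∧ run (advance s a) w = some t := by
  rw [run, Option.bind_eq_some_iff]
  constructor
  · rintro ⟨s', h, h'⟩
    obtain rfl := eq_advance_of_step h
    exact ⟨h, h'⟩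
  · rintro ⟨h, h'⟩
    exact ⟨_, h, h'⟩

theorem length_add_countP_of_run {s t : List Burger} {w : List Letter} (h : run s w = some t) :
    s.length + w.countP (fun a => a.isBurger) = t.length + w.countP (fun a => !a.isBurger) := by
  induction w generalizing s with
  | nil => simp_all [run]
  | cons a w ih =>
    obtain ⟨h1, h2⟩ := run_cons_eq_some.1 h
    have h3 := ih h2
    rcases a with b | b | _
    · have h4 : (Letter.produce b).isBurger = true := rfl
      simp [advance, h4] at h3 ⊢
      omega
    · have h4 : (Letter.order b).isBurger = false := rfl
      have hb : b ∈ s := by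
        by_contra hb
        simp [step, hb] at h1
      have := List.length_erase_add_one hb
      simp only [advance, List.countP_cons, h4, Bool.not_false, Bool.false_eq_true, if_false,
        if_true] at h3 ⊢
      omega
    · have h4 : Letter.fresh.isBurger = false := rfl
      rcases s with _ | ⟨c, s⟩
      · simp [step] at h1
      · simp [advance, h4] at h3 ⊢
        omega

theorem hasOrder_iff_length_of_isPerfect {w : List Letter} {n : ℕ} (h : IsPerfect w) :
    HasOrder n w ↔ w.length = 2 * n := by
  refine ⟨HasOrder.length_eq, fun hw => ?_⟩
  have h1 := List.length_eq_countP_add_countP (fun a : Letter => a.isBurger) (l := w)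
  have h2 := length_add_countP_of_run h
  simp only [Bool.not_eq_true, Bool.decide_eq_false] at h1
  simp only [List.length_nil, zero_add] at h2
  constructor <;> omega

/-! ### Orders classified by the topmost burger -/

/-- The number of letters `order b` of a word read from the stack `s` with the burger `t` on top of
the stack, where orders that cannot be fulfilled are ignored. -/
def orderCount (b t : Burger) : List Burger → List Letter → ℕ
  | _, [] => 0
  | s, a :: w => (if a = .order b ∧ s.head? = some t then 1 else 0) + orderCount b t (advance s a) w

/-- In a word read from the stack `s`, each `fresh` sees a cheeseburger on top. -/
def FreshOnCheese : List Burger → List Letter → Prop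
  | _, [] => True
  | s, a :: w => (a = .fresh → s.head? = some .cheese) ∧ FreshOnCheese (advance s a) w

theorem freshOnCheese_iff {s t : List Burger} {w : List Letter} (h : run s w = some t) :
    FreshOnCheese s w ↔ ∀ u v : List Letter, w = u ++ Letter.fresh :: v →
      ∃ r : List Burger, run s u = some (.cheese :: r) := by
  induction w generalizing s with
  | nil => simp [FreshOnCheese]
  | cons a w ih =>
    obtain ⟨h1, h2⟩ := run_cons_eq_some.1 h
    rw [FreshOnCheese, ih h2]
    constructor
    · rintro ⟨h3, h4⟩ u v huv
      rcases u with _ | ⟨c, u⟩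
      · simp only [List.nil_append, List.cons.injEq] at huv
        have := h3 huv.1
        rcases s with _ | ⟨c, s⟩
        · simp at this
        · exact ⟨s, by simp_all [run]⟩
      · simp only [List.cons_append, List.cons.injEq] at huv
        obtain ⟨rfl, rfl⟩ := huv
        obtain ⟨r, hr⟩ := h4 u v rfl
        exact ⟨r, run_cons_eq_some.2 ⟨h1, hr⟩⟩
    · intro h3
      constructor
      · rintro rfl
        obtain ⟨r, hr⟩ := h3 [] w rfl
        simp only [run, Option.some.injEq] at hr
        simp [hr]
      · rintro u v rfl
        obtain ⟨r, hr⟩ := h3 (a :: u) v rfl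
        exact ⟨r, (run_cons_eq_some.1 hr).2⟩

-- Replacing `F` by `c` leaves the run unchanged; conversely, any `k` of the letters `c` read with
-- cheese on top may be turned into `F`. A general starting stack lets the induction peel off the
-- first letter.
open Classical in
theorem card_freshOnCheese (L : ℕ) (k : ℕ) (s : List Burger) :
    (∑ w ∈ words letters L,
      if run s w = some [] ∧ w.count .fresh = k ∧ FreshOnCheese s w then 1 else 0) =
    ∑ w ∈ words plain L,
      if run s w = some [] then (orderCount .cheese .cheese s w).choose k else 0 := by
  induction L generalizing k s with
  | zero =>
    rw [sum_words_zero, sum_words_zero]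
    rcases k with _ | k <;> simp [orderCount, FreshOnCheese]
  | succ L ih =>
    have hp : ∀ b : Burger, (∑ w ∈ words letters L,
        if run s (.produce b :: w) = some [] ∧ (Letter.produce b :: w).count .fresh = k ∧
          FreshOnCheese s (.produce b :: w) then 1 else 0) =
        ∑ w ∈ words plain L, if run s (.produce b :: w) = some [] then
          (orderCount .cheese .cheese s (.produce b :: w)).choose k else 0 := by
      intro b
      simpa [run_cons_produce, FreshOnCheese, orderCount, advance] using ih k (b :: s)
    have hham : (∑ w ∈ words letters L,
        if run s (.order .ham :: w) = some [] ∧ (Letter.order .ham :: w).count .fresh = k ∧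
          FreshOnCheese s (.order .ham :: w) then 1 else 0) =
        ∑ w ∈ words plain L, if run s (.order .ham :: w) = some [] then
          (orderCount .cheese .cheese s (.order .ham :: w)).choose k else 0 := by
      by_cases hb : Burger.ham ∈ s
      · simpa [run_cons_order, hb, FreshOnCheese, orderCount, advance] using ih k (s.erase .ham)
      · simp [run_cons_order, hb]
    have hcheese : (∑ w ∈ words letters L,
        if run s (.order .cheese :: w) = some [] ∧ (Letter.order .cheese :: w).count .fresh = k ∧
          FreshOnCheese s (.order .cheese :: w) then 1 else 0) +
        (∑ w ∈ words letters L,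
        if run s (.fresh :: w) = some [] ∧ (Letter.fresh :: w).count .fresh = k ∧
          FreshOnCheese s (.fresh :: w) then 1 else 0) =
        ∑ w ∈ words plain L, if run s (.order .cheese :: w) = some [] then
          (orderCount .cheese .cheese s (.order .cheese :: w)).choose k else 0 := by
      by_cases hs : s.head? = some .cheese
      · rcases s with _ | ⟨c, s⟩
        · simp at hs
        obtain rfl : c = .cheese := by simpa using hs
        rcases k with _ | k
        · simpa [run_cons_order, FreshOnCheese, orderCount, advance] using ih 0 s
        -- The first letters `c` and `F` lead to the same stack, so the two sums combine by Pascal's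
        -- rule.
        · have h1 := ih k s
          have h2 := ih (k + 1) s
          have h3 : ∀ w, run (.cheese :: s) (.fresh :: w) = run s w := fun w => rfl
          simp only [run_cons_order, FreshOnCheese, orderCount, advance, h3, List.mem_cons, true_or,
            if_true, List.erase_cons_head, List.head?_cons, and_self, List.count_cons_self,
            Nat.add_right_cancel_iff, List.tail_cons, true_and, implies_true, reduceCtorEq, ne_eq, not_false_eq_true, List.count_cons_of_ne]
          rw [h1, h2, ← sum_add_distrib]
          refine sum_congr rfl fun w _ => ?_
          split_ifs
          · rw [Nat.add_comm 1, Nat.choose_succ_succ, Nat.add_comm]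
          · rfl
      · by_cases hb : Burger.cheese ∈ s
        · simpa [run_cons_order, hb, hs, FreshOnCheese, orderCount, advance]
            using ih k (s.erase .cheese)
        · simp [run_cons_order, hb, hs, FreshOnCheese]
    rw [sum_words_succ, sum_words_succ, sum_letters, sum_plain, sum_plain, hp, hp, hham, ← hcheese]
    ring

/-- The set `Theta 0 n` as a finset. -/
def plainPerfect (n : ℕ) : Finset (List Letter) :=
  {w ∈ words plain (2 * n) | run [] w = some []}

theorem ncard_Theta (k n : ℕ) :
    (Theta k n).ncard = ∑ w ∈ plainPerfect n, (orderCount .cheese .cheese [] w).choose k := by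
  classical
  have h : Theta k n = ↑({w ∈ words letters (2 * n) |
      run [] w = some [] ∧ w.count .fresh = k ∧ FreshOnCheese [] w} : Finset (List Letter)) := by
    ext w
    simp only [Theta, Set.mem_ofPred_eq, coe_filter, mem_words, mem_letters, implies_true, and_true]
    by_cases hw : run [] w = some []
    · have hw' : IsPerfect w := hw
      rw [hasOrder_iff_length_of_isPerfect hw', freshOnCheese_iff hw, FreshFulfilledByCheese]
      tauto
    · simp [IsPerfect, hw]
  rw [h, Set.ncard_coe_finset, card_filter, card_freshOnCheese, plainPerfect, sum_filter]

theorem ncard_Theta_zero (n : ℕ) : (Theta 0 n).ncard = #(plainPerfect n) := by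
  rw [ncard_Theta, card_eq_sum_ones]
  simp

/-! ### A lower bound for the number of perfect words without fresh orders -/

/-- The function `(number of hamburgers + 1) * (number of cheeseburgers + 1)` of the stack; it is
harmonic for the walk killed when an order cannot be fulfilled. -/
def harmonic (s : List Burger) : ℕ := (s.count .ham + 1) * (s.count .cheese + 1)

theorem sum_harmonic (L : ℕ) (s : List Burger) :
    ∑ w ∈ words plain L, (run s w).elim 0 harmonic = 4 ^ L * harmonic s := by
  induction L generalizing s with
  | zero => simp [sum_words_zero, run]
  | succ L ih =>
    have horder : ∀ b, ∑ w ∈ words plain L, (run s (.order b :: w)).elim 0 harmonic =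
        4 ^ L * if b ∈ s then harmonic (s.erase b) else 0 := by
      intro b
      by_cases hb : b ∈ s
      · simp [run_cons_order, hb, ih]
      · simp [run_cons_order, hb]
    -- With `x`, `y` the two counts plus one, this is `(x+1)y + x(y+1) + (x-1)y + x(y-1) = 4xy`; a
    -- killed order contributes `0` because its factor `x-1` or `y-1` vanishes.
    have h : harmonic (.ham :: s) + (harmonic (.cheese :: s) +
        ((if .ham ∈ s then harmonic (s.erase .ham) else 0) +
          (if .cheese ∈ s then harmonic (s.erase .cheese) else 0))) = 4 * harmonic s := by
      have h1 : (if .ham ∈ s then harmonic (s.erase .ham) else 0) =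
          s.count .ham * (s.count .cheese + 1) := by
        split_ifs with hb
        · have := List.count_pos_iff.2 hb
          simp only [harmonic, List.count_erase_self, ne_eq, reduceCtorEq, not_false_eq_true,
            List.count_erase_of_ne]
          rw [Nat.sub_add_cancel this]
        · simp [List.count_eq_zero.2 hb]
      have h2 : (if .cheese ∈ s then harmonic (s.erase .cheese) else 0) =
          (s.count .ham + 1) * s.count .cheese := by
        split_ifs with hb
        · have := List.count_pos_iff.2 hb
          simp only [harmonic, List.count_erase_self, ne_eq, reduceCtorEq, not_false_eq_true,
            List.count_erase_of_ne]
          rw [Nat.sub_add_cancel this]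
        · simp [List.count_eq_zero.2 hb]
      rw [h1, h2]
      simp [harmonic]
      ring
    rw [sum_words_succ, sum_plain, horder, horder]
    simp only [run_cons_produce, ih]
    rw [pow_succ, mul_assoc, ← h]
    ring

/-- The letter that undoes a given letter (up to the order of the stack). -/
def Letter.inverse : Letter → Letter
  | .produce b => .order b
  | .order b => .produce b
  | .fresh => .fresh

theorem Letter.inverse_involutive : Function.Involutive Letter.inverse := by
  rintro (_ | _ | _) <;> rfl

/-- The word that undoes a given word (up to the order of the stack). -/
def inverseWord (w : List Letter) : List Letter := (w.map Letter.inverse).reverse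

theorem inverseWord_injective : Function.Injective inverseWord :=
  List.reverse_injective.comp (List.map_injective_iff.2 Letter.inverse_involutive.injective)

theorem inverseWord_mem_words {L : ℕ} {w : List Letter} (h : w ∈ words plain L) :
    inverseWord w ∈ words plain L := by
  simp only [mem_words, inverseWord, List.length_reverse, List.length_map, List.mem_reverse,
    List.mem_map, forall_exists_index, and_imp, forall_apply_eq_imp_iff₂, mem_plain] at h ⊢
  refine ⟨h.1, fun a ha h' => h.2 a ha ?_⟩
  rcases a with _ | _ | _ <;> simp_all [Letter.inverse]

/-- An undone order returns its burger to the top rather than to its old place, so stacks agree only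
up to permutation. That suffices: without `F`, whether a run succeeds depends only on the two
counts. -/
theorem exists_run_inverseWord {s t t' : List Burger} {w : List Letter}
    (hw : ∀ a ∈ w, a ∈ plain) (h : run s w = some t) (ht : t'.Perm t) :
    ∃ s' : List Burger, s'.Perm s ∧ run t' (inverseWord w) = some s' := by
  induction w generalizing s with
  | nil =>
    simp only [run, Option.some.injEq] at h
    exact ⟨t', h ▸ ht, rfl⟩
  | cons a w ih =>
    obtain ⟨h1, h2⟩ := run_cons_eq_some.1 h
    obtain ⟨s₁, hs₁, hrun⟩ := ih (fun a ha => hw a (List.mem_cons_of_mem _ ha)) h2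
    have happ : inverseWord (a :: w) = inverseWord w ++ [a.inverse] := by simp [inverseWord]
    rw [happ, run_append, hrun]
    rcases a with b | b | _
    · have hb : b ∈ s₁ := hs₁.symm.subset (by simp [advance])
      refine ⟨s₁.erase b, ?_, by simp [Letter.inverse, run, step, hb]⟩
      simpa [advance] using hs₁.erase b
    · refine ⟨b :: s₁, ?_, rfl⟩
      have hb : b ∈ s := by
        by_contra hb
        simp [step, hb] at h1
      exact (hs₁.cons b).trans (List.perm_cons_erase hb).symm
    · exact absurd rfl (mem_plain.1 (hw .fresh (by simp)))

theorem length_le_of_run {s t : List Burger} {w : List Letter} (h : run s w = some t) :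
    t.length ≤ s.length + w.length := by
  have h1 := length_add_countP_of_run h
  have h2 := List.countP_le_length (p := fun a : Letter => a.isBurger) (l := w)
  omega

/-- The numbers of hamburgers and cheeseburgers in the stack after reading a word. -/
def finalCounts (w : List Letter) : ℕ × ℕ :=
  (run [] w).elim (0, 0) fun t => (t.count .ham, t.count .cheese)

/-- Two surviving words with equal final counts glue to a perfect word, the first followed by the
inverse of the second. Cauchy–Schwarz over the at most `(m + 1) ^ 2` final counts bounds the number
of such pairs from below. -/
theorem sq_card_le (m : ℕ) :
    #{w ∈ words plain m | (run [] w).isSome} ^ 2 ≤ (m + 1) ^ 2 * #(plainPerfect m) := by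
  set W : Finset (List Letter) := {w ∈ words plain m | (run [] w).isSome} with hW
  have hmaps : (W : Set (List Letter)).MapsTo finalCounts
      ↑(range (m + 1) ×ˢ range (m + 1) : Finset (ℕ × ℕ)) := by
    intro w hw
    simp only [hW, coe_filter, Set.mem_ofPred_eq, Option.isSome_iff_exists, mem_words] at hw
    obtain ⟨⟨hw, _⟩, t, ht⟩ := hw
    have h1 := length_le_of_run ht
    have h2 := List.count_le_length (a := Burger.ham) (l := t)
    have h3 := List.count_le_length (a := Burger.cheese) (l := t)
    simp only [List.length_nil] at h1
    simp only [finalCounts, ht, Option.elim_some, coe_product, coe_range, Set.mem_prod, Set.mem_Iio]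
    omega
  have hpairs : ∑ q ∈ range (m + 1) ×ˢ range (m + 1), #{w ∈ W | finalCounts w = q} ^ 2 ≤
      #(plainPerfect m) := by
    have h1 : ∀ q : ℕ × ℕ, #{w ∈ W | finalCounts w = q} ^ 2 =
        #{p ∈ (W ×ˢ W).filter (fun p => finalCounts p.1 = finalCounts p.2) |
          finalCounts p.1 = q} := by
      intro q
      rw [sq, ← card_product]
      congr 1
      ext ⟨u, v⟩
      simp only [mem_product, mem_filter]
      constructor
      · rintro ⟨⟨h1, rfl⟩, h2, h3⟩
        exact ⟨⟨⟨h1, h2⟩, h3.symm⟩, rfl⟩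
      · rintro ⟨⟨⟨h1, h2⟩, h3⟩, rfl⟩
        exact ⟨⟨h1, rfl⟩, h2, h3.symm⟩
    simp only [h1]
    rw [← card_eq_sum_card_fiberwise]
    · refine card_le_card_of_injOn (fun p => p.1 ++ inverseWord p.2) ?_ ?_
      · rintro ⟨u, v⟩ huv
        simp only [hW, coe_filter, mem_product, mem_filter, Set.mem_ofPred_eq,
          Option.isSome_iff_exists] at huv
        obtain ⟨⟨⟨hu, t, ht⟩, hv, t', ht'⟩, heq⟩ := huv
        simp only [finalCounts, ht, ht', Option.elim_some, Prod.mk.injEq] at heq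
        have hperm : t.Perm t' := List.perm_iff_count.2 (by rintro (_ | _); exacts [heq.1, heq.2])
        obtain ⟨s, hs, hrun⟩ := exists_run_inverseWord (mem_words.1 hv).2 ht' hperm
        obtain rfl := hs.eq_nil
        have hv' := mem_words.1 (inverseWord_mem_words hv)
        have hu' := mem_words.1 hu
        simp only [plainPerfect, coe_filter, Set.mem_ofPred_eq, mem_words, List.length_append,
          List.mem_append, run_append, ht, Option.bind_some, hrun, and_true]
        refine ⟨by omega, ?_⟩
        rintro a (ha | ha)
        exacts [hu'.2 a ha, hv'.2 a ha]
      · rintro ⟨u, v⟩ huv ⟨u', v'⟩ huv' heq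
        simp only [hW, coe_filter, mem_product, mem_filter, Set.mem_ofPred_eq, mem_words] at huv huv'
        have := List.append_inj heq (by rw [huv.1.1.1.1, huv'.1.1.1.1])
        simp only [Prod.mk.injEq]
        exact ⟨this.1, inverseWord_injective this.2⟩
    · rintro ⟨u, v⟩ huv
      simp only [coe_filter, mem_product, Set.mem_ofPred_eq] at huv
      exact hmaps huv.1.1
  calc #W ^ 2 = (∑ q ∈ range (m + 1) ×ˢ range (m + 1), #{w ∈ W | finalCounts w = q}) ^ 2 := by
        rw [← card_eq_sum_card_fiberwise hmaps]
    _ ≤ #(range (m + 1) ×ˢ range (m + 1)) *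
        ∑ q ∈ range (m + 1) ×ˢ range (m + 1), #{w ∈ W | finalCounts w = q} ^ 2 :=
        sq_sum_le_card_mul_sum_sq
    _ ≤ (m + 1) ^ 2 * #(plainPerfect m) := by
        rw [card_product, card_range, ← sq]
        exact Nat.mul_le_mul_left _ hpairs

/-- The harmonic weights sum to `4 ^ m` and each is at most `(m + 1) ^ 2`, so at least `4 ^ m / (m +
1) ^ 2` words survive; `sq_card_le` then applies. -/
theorem pow_le_card_plainPerfect (m : ℕ) : 16 ^ m ≤ (m + 1) ^ 6 * #(plainPerfect m) := by
  have h1 : 4 ^ m ≤ #{w ∈ words plain m | (run [] w).isSome} * (m + 1) ^ 2 := by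
    calc 4 ^ m = ∑ w ∈ words plain m, (run [] w).elim 0 harmonic := by
          rw [sum_harmonic]; simp [harmonic]
      _ = ∑ w ∈ words plain m with (run [] w).isSome, (run [] w).elim 0 harmonic := by
          rw [sum_filter]
          refine sum_congr rfl fun w _ => ?_
          cases run [] w <;> simp
      _ ≤ ∑ w ∈ words plain m with (run [] w).isSome, (m + 1) ^ 2 := by
          refine sum_le_sum fun w hw => ?_
          simp only [mem_filter, Option.isSome_iff_exists, mem_words] at hw
          obtain ⟨⟨hw, _⟩, t, ht⟩ := hw
          have h1 := length_le_of_run ht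
          have h2 := List.count_le_length (a := Burger.ham) (l := t)
          have h3 := List.count_le_length (a := Burger.cheese) (l := t)
          simp only [List.length_nil] at h1
          rw [ht, Option.elim_some, harmonic, sq]
          exact Nat.mul_le_mul (by omega) (by omega)
      _ = _ := by rw [sum_const, smul_eq_mul]
  calc 16 ^ m = (4 ^ m) ^ 2 := by rw [← pow_mul, mul_comm, pow_mul]; norm_num
    _ ≤ (#{w ∈ words plain m | (run [] w).isSome} * (m + 1) ^ 2) ^ 2 := Nat.pow_le_pow_left h1 2
    _ = (m + 1) ^ 4 * #{w ∈ words plain m | (run [] w).isSome} ^ 2 := by ring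
    _ ≤ (m + 1) ^ 4 * ((m + 1) ^ 2 * #(plainPerfect m)) := Nat.mul_le_mul_left _ (sq_card_le m)
    _ = _ := by ring

/-! ### Orders classified by the topmost burger: superadditivity and mean -/

theorem orderCount_append (b t : Burger) (s : List Burger) (u v : List Letter) :
    orderCount b t s (u ++ v) = orderCount b t s u + orderCount b t (u.foldl advance s) v := by
  induction u generalizing s with
  | nil => simp [orderCount]
  | cons a u ih => simp [orderCount, ih, add_assoc]

/-- Since the head is the top, `s` is `r` with extra burgers underneath. An order missing from `r`
can only remove one of these extras. -/
theorem advance_prefix {r s : List Burger} (h : r <+: s) (a : Letter) :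
    advance r a <+: advance s a := by
  obtain ⟨q, rfl⟩ := h
  rcases a with b | b | _
  · exact ⟨q, rfl⟩
  · simp only [advance, List.erase_append]
    split_ifs with hb
    · exact List.prefix_append _ _
    · rw [List.erase_of_not_mem hb]
      exact List.prefix_append _ _
  · rcases r with _ | ⟨c, r⟩
    · exact List.nil_prefix
    · exact List.prefix_append _ _

/-- Burgers added underneath do not change the top of a nonempty stack, and an empty stack
contributes nothing to the count. -/
theorem orderCount_mono (b t : Burger) {r s : List Burger} (h : r <+: s) (w : List Letter) :
    orderCount b t r w ≤ orderCount b t s w := by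
  induction w generalizing r s with
  | nil => rfl
  | cons a w ih =>
    refine add_le_add ?_ (ih (advance_prefix h a))
    obtain ⟨q, rfl⟩ := h
    rcases r with _ | ⟨c, r⟩ <;> simp

theorem orderCount_superadditive (b t : Burger) (u v : List Letter) :
    orderCount b t [] u + orderCount b t [] v ≤ orderCount b t [] (u ++ v) := by
  rw [orderCount_append]
  exact Nat.add_le_add_left (orderCount_mono b t List.nil_prefix v) _

theorem orderCount_le_length (b t : Burger) (s : List Burger) (w : List Letter) :
    orderCount b t s w ≤ w.length := by
  induction w generalizing s with
  | nil => rfl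
  | cons a w ih =>
    have := ih (advance s a)
    rw [orderCount, List.length_cons]
    split_ifs <;> omega

theorem sum_orderCount (s t : List Burger) (w : List Letter) (hw : ∀ a ∈ w, a ∈ plain)
    (h : run s w = some t) :
    orderCount .ham .ham s w + orderCount .ham .cheese s w +
      (orderCount .cheese .ham s w + orderCount .cheese .cheese s w) =
      w.countP (fun a => !a.isBurger) := by
  induction w generalizing s with
  | nil => simp [orderCount]
  | cons a w ih =>
    obtain ⟨h1, h2⟩ := run_cons_eq_some.1 h
    rw [List.countP_cons, ← ih _ (fun a ha => hw a (List.mem_cons_of_mem _ ha)) h2]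
    simp only [orderCount]
    rcases a with b | b | _
    · simp [Letter.isBurger]
    · rcases s with _ | ⟨c, s⟩
      · simp [step] at h1
      · rcases b with _ | _ <;> rcases c with _ | _ <;> simp [Letter.isBurger] <;> omega
    · exact absurd rfl (mem_plain.1 (hw .fresh (by simp)))

/-- Exchange the two types of burgers. -/
def Burger.swap : Burger → Burger
  | .ham => .cheese
  | .cheese => .ham

theorem Burger.swap_injective : Function.Injective Burger.swap := by
  rintro (_ | _) (_ | _) <;> simp [Burger.swap]

/-- Exchange the two types of burgers in a letter. -/
def Letter.swap : Letter → Letter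
  | .produce b => .produce b.swap
  | .order b => .order b.swap
  | .fresh => .fresh

theorem advance_swap (s : List Burger) (a : Letter) :
    advance (s.map Burger.swap) a.swap = (advance s a).map Burger.swap := by
  rcases a with b | b | _
  · rfl
  · exact (List.map_erase Burger.swap_injective s).symm
  · simp [advance, Letter.swap]

theorem foldl_advance_swap (s : List Burger) (w : List Letter) :
    (w.map Letter.swap).foldl advance (s.map Burger.swap) =
      (w.foldl advance s).map Burger.swap := by
  induction w generalizing s with
  | nil => rfl
  | cons a w ih => rw [List.map_cons, List.foldl_cons, List.foldl_cons, advance_swap, ih]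

theorem sum_words_swap (L : ℕ) (f : List Letter → ℕ) :
    ∑ w ∈ words plain L, f (w.map Letter.swap) = ∑ w ∈ words plain L, f w := by
  induction L generalizing f with
  | zero => simp [sum_words_zero]
  | succ L ih =>
    have h : ∀ a : Letter, ∑ w ∈ words plain L, f (a.swap :: w.map Letter.swap) =
        ∑ w ∈ words plain L, f (a.swap :: w) := fun a => ih fun w => f (a.swap :: w)
    simp only [sum_words_succ, List.map_cons, h]
    simp only [sum_plain, Letter.swap, Burger.swap]
    ring

/-- By the symmetry exchanging the burger types, both types are equally often on top. -/
theorem sum_top (L : ℕ) (t : Burger) :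
    2 * (∑ w ∈ words plain L, if (w.foldl advance []).head? = some t then 1 else 0) +
      (∑ w ∈ words plain L, if w.foldl advance [] = [] then 1 else 0) = 4 ^ L := by
  have h1 : (∑ w ∈ words plain L, if (w.foldl advance []).head? = some t.swap then 1 else 0) =
      ∑ w ∈ words plain L, if (w.foldl advance []).head? = some t then 1 else 0 := by
    rw [← sum_words_swap]
    refine sum_congr rfl fun w _ => ?_
    have h := foldl_advance_swap [] w
    rw [List.map_nil] at h
    rw [h, List.head?_map]
    rcases (w.foldl advance []).head? with _ | (_ | _) <;> rcases t with _ | _ <;>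
      simp [Burger.swap]
  calc _ = ∑ w ∈ words plain L, 1 := by
        rw [two_mul]
        nth_rewrite 2 [← h1]
        rw [← sum_add_distrib, ← sum_add_distrib]
        refine sum_congr rfl fun w _ => ?_
        rcases w.foldl advance [] with _ | ⟨_ | _, _⟩ <;> rcases t with _ | _ <;>
          simp [Burger.swap]
    _ = 4 ^ L := by rw [← card_eq_sum_ones, card_words_plain]

/-- The number of cheeseburgers left by a word whose impossible orders are ignored. -/
def cheeseLeft (w : List Letter) : ℕ := (w.foldl advance []).count .cheese

/-- `cheeseLeft` is a lazy walk held at `0` by ignored orders. Its mean grows only through visits to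
`0`, so a bound on the mean bounds the number of visits, and thus of empty stacks. -/
theorem sum_cheeseLeft_concat (w : List Letter) :
    ∑ a ∈ plain, cheeseLeft (w ++ [a]) =
      4 * cheeseLeft w + if cheeseLeft w = 0 then 1 else 0 := by
  have h : ∑ a ∈ plain, cheeseLeft (w ++ [a]) =
      cheeseLeft w + (cheeseLeft w + 1 + (cheeseLeft w + (cheeseLeft w - 1))) := by
    simp only [sum_plain, cheeseLeft, List.foldl_append, List.foldl_cons, List.foldl_nil, advance,
      List.count_cons_self, ne_eq, reduceCtorEq, not_false_eq_true, List.count_cons_of_ne,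
      List.count_erase_self, List.count_erase_of_ne]
  rw [h]
  split_ifs <;> omega

theorem sum_sq_cheeseLeft_concat (w : List Letter) :
    ∑ a ∈ plain, cheeseLeft (w ++ [a]) ^ 2 ≤ 4 * cheeseLeft w ^ 2 + 2 := by
  simp only [sum_plain, cheeseLeft, List.foldl_append, List.foldl_cons, List.foldl_nil, advance,
    List.count_cons_self, ne_eq, reduceCtorEq, not_false_eq_true, List.count_cons_of_ne,
    List.count_erase_self, List.count_erase_of_ne]
  generalize (w.foldl advance []).count .cheese = n
  rcases n with _ | n
  · simp
  · rw [Nat.add_sub_cancel]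
    nlinarith

theorem sum_sq_cheeseLeft_le (L : ℕ) :
    2 * ∑ w ∈ words plain L, cheeseLeft w ^ 2 ≤ L * 4 ^ L := by
  induction L with
  | zero => simp [sum_words_zero, cheeseLeft]
  | succ L ih =>
    have h : ∑ w ∈ words plain (L + 1), cheeseLeft w ^ 2 ≤
        4 * (∑ w ∈ words plain L, cheeseLeft w ^ 2) + 2 * 4 ^ L := by
      rw [sum_words_concat]
      refine (sum_le_sum fun w _ => sum_sq_cheeseLeft_concat w).trans_eq ?_
      rw [sum_add_distrib, ← mul_sum, sum_const, card_words_plain, smul_eq_mul, mul_comm 2]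
    rw [pow_succ]
    nlinarith

theorem sq_sum_cheeseLeft_le (L : ℕ) :
    (∑ w ∈ words plain L, cheeseLeft w) ^ 2 ≤ L * (4 ^ L) ^ 2 := by
  have h1 := sq_sum_le_card_mul_sum_sq (s := words plain L) (f := cheeseLeft)
  rw [card_words_plain] at h1
  have h2 := sum_sq_cheeseLeft_le L
  nlinarith [Nat.mul_le_mul_left (4 ^ L) h2,
    Nat.zero_le (4 ^ L * ∑ w ∈ words plain L, cheeseLeft w ^ 2)]

theorem sum_orderCount_concat (b t : Burger) (w : List Letter) :
    ∑ a ∈ plain, orderCount b t [] (w ++ [a]) =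
      4 * orderCount b t [] w + if (w.foldl advance []).head? = some t then 1 else 0 := by
  simp only [orderCount_append, sum_plain, orderCount]
  rcases b with _ | _ <;> simp <;> ring

/-- A new letter is `order b` with probability `1/4` and sees `t` on top with probability `(1 -
P(empty)) / 2`, whence the rate `1/8`. The loss from empty stacks is paid for by the growth of the
mean of `cheeseLeft`. -/
theorem le_sum_orderCount_add (b t : Burger) (L : ℕ) :
    L * 4 ^ L ≤ 8 * (∑ w ∈ words plain L, orderCount b t [] w) +
      4 * ∑ w ∈ words plain L, cheeseLeft w := by
  induction L with
  | zero => simp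
  | succ L ih =>
    have h1 := sum_top L t
    have h2 : (∑ w ∈ words plain L, if w.foldl advance [] = [] then 1 else 0) ≤
        ∑ w ∈ words plain L, if cheeseLeft w = 0 then 1 else 0 := by
      refine sum_le_sum fun w _ => ?_
      by_cases h : w.foldl advance [] = []
      · simp [h, cheeseLeft]
      · simp [h]
    simp only [sum_words_concat, sum_orderCount_concat, sum_cheeseLeft_concat, sum_add_distrib,
      ← mul_sum]
    rw [pow_succ]
    linarith

theorem exists_le_sum_orderCount (b t : Burger) {ν : ℝ} (hν : ν < 1 / 8) :
    ∃ ℓ : ℕ, 0 < ℓ ∧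
      ν * ℓ * 4 ^ ℓ ≤ ∑ w ∈ words plain ℓ, (orderCount b t [] w : ℝ) := by
  -- For `ℓ = k ^ 2` the mean of `cheeseLeft` is at most `k`, so the loss per letter is at most `4k
  -- / (8k²) = 1 / (2k)`, below `1/8 - ν`.
  obtain ⟨k, hk⟩ := exists_nat_gt (1 / (2 * (1 / 8 - ν)))
  have hε : 0 < 1 / 8 - ν := by linarith
  have hk0 : (0 : ℝ) < k := lt_trans (by positivity) hk
  rw [div_lt_iff₀ (by positivity)] at hk
  refine ⟨k ^ 2, pow_pos (by exact_mod_cast hk0) 2, ?_⟩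
  have h1 := sq_sum_cheeseLeft_le (k ^ 2)
  have h2 : ∑ w ∈ words plain (k ^ 2), cheeseLeft w ≤ k * 4 ^ k ^ 2 := by
    rw [← mul_pow] at h1
    exact (Nat.pow_le_pow_iff_left two_ne_zero).1 h1
  have h3 := le_sum_orderCount_add b t (k ^ 2)
  rw [← Nat.cast_sum]
  set P := 4 ^ k ^ 2 with hP
  have hP0 : (0 : ℝ) < P := by rw [hP]; positivity
  have h4 : (k : ℝ) ^ 2 * P ≤ 8 * ((∑ w ∈ words plain (k ^ 2), orderCount b t [] w : ℕ) : ℝ) +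
      4 * (k * P) := by
    have h5 : k ^ 2 * P ≤ 8 * (∑ w ∈ words plain (k ^ 2), orderCount b t [] w) + 4 * (k * P) := by
      omega
    exact_mod_cast h5
  have hP' : (4 : ℝ) ^ k ^ 2 = P := by rw [hP]; push_cast; rfl
  rw [hP']
  push_cast
  push_cast at h4
  have h6 : (k : ℝ) * P ≤ (k * P) * (k * (2 * (1 / 8 - ν))) :=
    le_mul_of_one_le_right (by positivity) hk.le
  nlinarith

/-! ### Lower deviations of superadditive functions of words -/

/-- Superadditivity makes `exp (-c f)` submultiplicative, so the sum over words factors over `N`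
blocks; the `r` leftover letters are bounded trivially. -/
theorem sum_exp_le_pow {f : List Letter → ℕ} (hf : ∀ u v, f u + f v ≤ f (u ++ v)) {c : ℝ}
    (hc : 0 ≤ c) (ℓ N r : ℕ) :
    ∑ w ∈ words plain (ℓ * N + r), Real.exp (-(c * f w)) ≤
      (∑ w ∈ words plain ℓ, Real.exp (-(c * f w))) ^ N * 4 ^ r := by
  have hadd : ∀ K L : ℕ, ∑ w ∈ words plain (K + L), Real.exp (-(c * f w)) ≤
      (∑ w ∈ words plain K, Real.exp (-(c * f w))) *
        ∑ w ∈ words plain L, Real.exp (-(c * f w)) := by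
    intro K L
    rw [sum_words_add, sum_mul_sum]
    refine sum_le_sum fun u _ => sum_le_sum fun v _ => ?_
    rw [← Real.exp_add, Real.exp_le_exp]
    have : ((f u + f v : ℕ) : ℝ) ≤ f (u ++ v) := by exact_mod_cast hf u v
    push_cast at this
    nlinarith
  have htriv : ∀ L : ℕ, ∑ w ∈ words plain L, Real.exp (-(c * f w)) ≤ 4 ^ L := by
    intro L
    calc _ ≤ ∑ w ∈ words plain L, (1 : ℝ) := by
          refine sum_le_sum fun w _ => ?_
          rw [Real.exp_le_one_iff, neg_nonpos]
          positivity
      _ = 4 ^ L := by simp [card_words_plain]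
  induction N with
  | zero => simpa using htriv r
  | succ N ih =>
    rw [show ℓ * (N + 1) + r = ℓ + (ℓ * N + r) by ring, pow_succ', mul_assoc]
    refine (hadd _ _).trans ?_
    exact mul_le_mul_of_nonneg_left ih (sum_nonneg fun w _ => (Real.exp_pos _).le)

theorem exists_card_lower_deviation_le {f : List Letter → ℕ}
    (hf : ∀ u v, f u + f v ≤ f (u ++ v)) (hlen : ∀ w, f w ≤ w.length) {μ ν : ℝ} (hμν : μ < ν)
    (hμ : 0 ≤ μ)
    (hmean : ∃ ℓ : ℕ, 0 < ℓ ∧ ν * ℓ * 4 ^ ℓ ≤ ∑ w ∈ words plain ℓ, (f w : ℝ)) :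
    ∃ C ρ : ℝ, 0 < ρ ∧ ρ < 1 ∧ ∀ L : ℕ,
      (#{w ∈ words plain L | (f w : ℝ) ≤ μ * L} : ℝ) ≤ C * ρ ^ L * 4 ^ L := by
  obtain ⟨ℓ, hℓ, hmean⟩ := hmean
  have hℓ' : (0 : ℝ) < ℓ := by exact_mod_cast hℓ
  set κ := (μ + ν) / 2 with hκ
  -- The first bound permits `exp (-x) ≤ 1 - x + x²` for `x = c * f w`; the second keeps the
  -- quadratic loss from lowering the rate `ν` below `κ`.
  obtain ⟨c, hc, hc1, hc2⟩ : ∃ c : ℝ, 0 < c ∧ c * ℓ ≤ 1 ∧ c * ℓ ≤ ν - κ := by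
    refine ⟨min 1 (ν - κ) / ℓ, div_pos (lt_min one_pos (by rw [hκ]; linarith)) hℓ', ?_, ?_⟩
    · rw [div_mul_cancel₀ _ hℓ'.ne']; exact min_le_left _ _
    · rw [div_mul_cancel₀ _ hℓ'.ne']; exact min_le_right _ _
  have hκ0 : 0 < κ := by rw [hκ]; linarith
  have hblock : ∑ w ∈ words plain ℓ, Real.exp (-(c * f w)) ≤
      4 ^ ℓ * Real.exp (-(c * ℓ * κ)) := by
    have h1 : ∀ w ∈ words plain ℓ, Real.exp (-(c * f w)) ≤ 1 - c * f w + (c * ℓ) ^ 2 := by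
      intro w hw
      have h2 : (f w : ℝ) ≤ ℓ := by
        rw [← (mem_words.1 hw).1]; exact_mod_cast hlen w
      have h3 : c * f w ≤ c * ℓ := mul_le_mul_of_nonneg_left h2 hc.le
      have h0 : 0 ≤ c * f w := by positivity
      have h4 := Real.abs_exp_sub_one_sub_id_le (x := -(c * f w))
        (by rw [abs_neg, abs_of_nonneg h0]; linarith)
      have h5 := (abs_le.1 h4).2
      have h6 : (c * (f w : ℝ)) ^ 2 ≤ (c * ℓ) ^ 2 := pow_le_pow_left₀ h0 h3 2
      rw [neg_sq] at h5
      linarith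
    calc _ ≤ ∑ w ∈ words plain ℓ, (1 - c * f w + (c * ℓ) ^ 2) := sum_le_sum h1
      _ = 4 ^ ℓ * (1 + (c * ℓ) ^ 2) - c * ∑ w ∈ words plain ℓ, (f w : ℝ) := by
          rw [sum_add_distrib, sum_sub_distrib, ← mul_sum]
          simp [card_words_plain]
          ring
      _ ≤ 4 ^ ℓ * (1 + (c * ℓ) ^ 2) - c * (ν * ℓ * 4 ^ ℓ) := by
          have := mul_le_mul_of_nonneg_left hmean hc.le
          linarith
      _ = 4 ^ ℓ * (-(c * ℓ * (ν - c * ℓ)) + 1) := by ring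
      _ ≤ 4 ^ ℓ * (-(c * ℓ * κ) + 1) := by
          have : c * ℓ * κ ≤ c * ℓ * (ν - c * ℓ) :=
            mul_le_mul_of_nonneg_left (by linarith) (by positivity)
          gcongr
      _ ≤ _ := by
          gcongr
          exact Real.add_one_le_exp _
  -- The constant absorbs the incomplete last block, of fewer than `ℓ` letters.
  refine ⟨Real.exp (c * κ * ℓ), Real.exp (-(c * (κ - μ))), Real.exp_pos _, ?_, fun L => ?_⟩
  · rw [Real.exp_lt_one_iff, neg_lt_zero]
    exact mul_pos hc (by rw [hκ]; linarith)
  have hL : ℓ * (L / ℓ) + L % ℓ = L := Nat.div_add_mod L ℓ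
  have h1 := sum_exp_le_pow hf hc.le ℓ (L / ℓ) (L % ℓ)
  rw [hL] at h1
  have h2 : (#{w ∈ words plain L | (f w : ℝ) ≤ μ * L} : ℝ) * Real.exp (-(c * (μ * L))) ≤
      ∑ w ∈ words plain L, Real.exp (-(c * f w)) := by
    rw [← nsmul_eq_mul, ← sum_const]
    refine (sum_le_sum fun w hw => ?_).trans
      (sum_le_sum_of_subset_of_nonneg (filter_subset _ _) fun w _ _ => (Real.exp_pos _).le)
    rw [Real.exp_le_exp, neg_le_neg_iff]
    exact mul_le_mul_of_nonneg_left (mem_filter.1 hw).2 hc.le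
  have h3 : (∑ w ∈ words plain ℓ, Real.exp (-(c * f w))) ^ (L / ℓ) * 4 ^ (L % ℓ) ≤
      4 ^ L * Real.exp (-(c * κ * (L - ℓ))) := by
    calc _ ≤ (4 ^ ℓ * Real.exp (-(c * ℓ * κ))) ^ (L / ℓ) * 4 ^ (L % ℓ) := by
          gcongr
      _ = 4 ^ (ℓ * (L / ℓ) + L % ℓ) * Real.exp ((L / ℓ : ℕ) * -(c * ℓ * κ)) := by
          rw [mul_pow, ← pow_mul, ← Real.exp_nat_mul, pow_add]
          ring
      _ ≤ _ := by
          rw [hL]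
          gcongr
          have h4 : (L : ℝ) - ℓ ≤ ℓ * (L / ℓ : ℕ) := by
            have h5 : L < ℓ * (L / ℓ) + ℓ := Nat.lt_mul_div_succ L hℓ
            have h6 : (L : ℝ) < ℓ * (L / ℓ : ℕ) + ℓ := by exact_mod_cast h5
            linarith
          have := mul_le_mul_of_nonneg_left h4 (mul_pos hc hκ0).le
          linarith
  have h4 := h2.trans (h1.trans h3)
  calc (#{w ∈ words plain L | (f w : ℝ) ≤ μ * L} : ℝ) =
      #{w ∈ words plain L | (f w : ℝ) ≤ μ * L} * Real.exp (-(c * (μ * L))) *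
        Real.exp (c * (μ * L)) := by
        rw [mul_assoc, ← Real.exp_add]; simp
    _ ≤ 4 ^ L * Real.exp (-(c * κ * (L - ℓ))) * Real.exp (c * (μ * L)) := by
        gcongr
    _ = Real.exp (c * κ * ℓ) * Real.exp (-(c * (κ - μ))) ^ L * 4 ^ L := by
        rw [← Real.exp_nat_mul, mul_assoc, ← Real.exp_add, ← Real.exp_add, mul_comm]
        congr 2
        ring

/-! ### Concentration on perfect words -/

/-- The words of length `2 * n` with few letters `order b` that are read below a topmost `t`. -/
noncomputable def sparseWords (μ : ℝ) (b t : Burger) (n : ℕ) : Finset (List Letter) :=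
  {w ∈ words plain (2 * n) | (orderCount b t [] w : ℝ) ≤ μ * (2 * n : ℕ)}

theorem tendsto_card_sparseWords_div (b t : Burger) {μ : ℝ} (h0 : 0 ≤ μ) (hμ : μ < 1 / 8) :
    Tendsto (fun n => (#(sparseWords μ b t n) : ℝ) / #(plainPerfect n)) atTop (𝓝 0) := by
  obtain ⟨ν, h1, h2⟩ := exists_between hμ
  obtain ⟨C, ρ, hρ, hρ1, hC⟩ := exists_card_lower_deviation_le (orderCount_superadditive b t)
    (orderCount_le_length b t []) h1 h0 (exists_le_sum_orderCount b t h2)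
  have hlim : Tendsto (fun n : ℕ => C / ρ ^ 2 * (((n + 1 : ℕ) : ℝ) ^ 6 * (ρ ^ 2) ^ (n + 1)))
      atTop (𝓝 0) := by
    have h3 := tendsto_pow_const_mul_const_pow_of_abs_lt_one 6 (r := ρ ^ 2)
      (by rw [abs_of_pos (by positivity)]; exact pow_lt_one₀ hρ.le hρ1 two_ne_zero)
    simpa using ((tendsto_add_atTop_iff_nat 1).2 h3).const_mul (C / ρ ^ 2)
  refine squeeze_zero (fun n => by positivity) (fun n => ?_) hlim
  have h3 : ((16 : ℝ)) ^ n ≤ (n + 1 : ℕ) ^ 6 * #(plainPerfect n) := by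
    exact_mod_cast pow_le_card_plainPerfect n
  have hpos : (0 : ℝ) < #(plainPerfect n) := by
    by_contra h
    have : ((n + 1 : ℕ) : ℝ) ^ 6 * #(plainPerfect n) ≤ 0 :=
      mul_nonpos_of_nonneg_of_nonpos (by positivity) (not_lt.1 h)
    have : (0 : ℝ) < 16 ^ n := by positivity
    linarith
  rw [div_le_iff₀ hpos]
  have hC0 : 0 ≤ C := by
    have := (Nat.cast_nonneg _).trans (hC 0)
    simpa using this
  calc (#(sparseWords μ b t n) : ℝ) ≤ C * ρ ^ (2 * n) * 4 ^ (2 * n) := hC (2 * n)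
    _ = C * (ρ ^ 2) ^ n * 16 ^ n := by rw [pow_mul, pow_mul]; norm_num
    _ ≤ C * (ρ ^ 2) ^ n * ((n + 1 : ℕ) ^ 6 * #(plainPerfect n)) := by gcongr
    _ = _ := by
      rw [pow_succ (ρ ^ 2) n]
      field_simp

/-- The binomial lies between `(x + 1 - k) ^ k / k!` and `x ^ k / k!`; after division by `n ^ k`,
continuity of `y ^ k / k!` at `1/4` controls both. -/
theorem exists_abs_choose_div_sub_le (k : ℕ) {δ : ℝ} (hδ : 0 < δ) :
    ∃ η : ℝ, 0 < η ∧ η ≤ 1 ∧ ∃ N : ℕ, ∀ n : ℕ, N ≤ n → ∀ x : ℕ,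
      |(x : ℝ) - n / 4| ≤ η * n →
        |(x.choose k : ℝ) / n ^ k - 1 / (k.factorial * 4 ^ k)| ≤ δ := by
  have hcont : ContinuousAt (fun y : ℝ => y ^ k / k.factorial) (1 / 4) := by fun_prop
  obtain ⟨ε, hε, hy⟩ := Metric.continuousAt_iff.1 hcont δ hδ
  simp only [Real.dist_eq] at hy
  have hval : (1 / 4 : ℝ) ^ k / k.factorial = 1 / (k.factorial * 4 ^ k) := by
    rw [div_pow, one_pow, div_div, mul_comm]
  rw [hval] at hy
  obtain ⟨N, hN⟩ := exists_nat_gt (k * 2 / ε)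
  rw [div_lt_iff₀ hε] at hN
  refine ⟨min 1 (ε / 3), by positivity, min_le_left _ _, N + 1, fun n hn x hx => ?_⟩
  have hn0 : (0 : ℝ) < n := by exact_mod_cast Nat.lt_of_lt_of_le (Nat.succ_pos N) hn
  have hn1 : (N : ℝ) ≤ n := by exact_mod_cast (Nat.le_succ N).trans hn
  have hx' : |(x : ℝ) - n / 4| ≤ ε / 3 * n :=
    hx.trans (mul_le_mul_of_nonneg_right (min_le_right _ _) hn0.le)
  have hk : (k : ℝ) < ε / 2 * n := by nlinarith
  rw [abs_le] at hx'
  have hclose : ∀ z : ℝ, z ≤ x → x - k ≤ z → |z / n - 1 / 4| < ε := by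
    intro z h1 h2
    have : z / n - 1 / 4 = (z - n / 4) / n := by field_simp
    rw [this, abs_div, abs_of_pos hn0, div_lt_iff₀ hn0, abs_lt]
    constructor <;> nlinarith
  -- For `k = 0` the lower base `x + 1` exceeds `x`, so that case is treated separately.
  have hsub1 : ((x + 1 - k : ℕ) : ℝ) ≤ x ∨ k = 0 := by
    rcases k with _ | k
    · exact Or.inr rfl
    · left; exact_mod_cast (by omega : x + 1 - (k + 1) ≤ x)
  rcases hsub1 with hsub1 | rfl
  swap
  · simpa using hδ.le
  have hsub2 : (x : ℝ) - k ≤ (x + 1 - k : ℕ) := by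
    rw [sub_le_iff_le_add]
    exact_mod_cast (by omega : x ≤ x + 1 - k + k)
  have hup := hy (hclose x le_rfl (by linarith [(Nat.cast_nonneg k : (0 : ℝ) ≤ k)]))
  have hlow := hy (hclose _ hsub1 hsub2)
  have hfac : (0 : ℝ) < k.factorial := by exact_mod_cast k.factorial_pos
  have h1 : (x.choose k : ℝ) / n ^ k ≤ (x / n) ^ k / k.factorial := by
    rw [div_pow, div_right_comm]
    gcongr
    exact Nat.choose_le_pow_div k x
  have h2 : (((x + 1 - k : ℕ) : ℝ) / n) ^ k / k.factorial ≤ (x.choose k : ℝ) / n ^ k := by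
    rw [div_pow, div_right_comm]
    gcongr
    rw [div_le_iff₀' hfac]
    have := Nat.pow_sub_le_descFactorial x k
    rw [Nat.descFactorial_eq_factorial_mul_choose] at this
    exact_mod_cast this
  rw [abs_lt] at hup hlow
  rw [abs_le]
  constructor <;> linarith

theorem sum_orderCount_of_mem_plainPerfect {n : ℕ} {w : List Letter} (hw : w ∈ plainPerfect n) :
    orderCount .ham .ham [] w + orderCount .ham .cheese [] w +
      (orderCount .cheese .ham [] w + orderCount .cheese .cheese [] w) = n := by
  obtain ⟨hw, hrun⟩ := mem_filter.1 hw
  obtain ⟨hlen, hplain⟩ := mem_words.1 hw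
  rw [sum_orderCount _ _ _ hplain hrun]
  exact ((hasOrder_iff_length_of_isPerfect hrun).2 hlen).2

theorem sum_indicator_le (n : ℕ) (S : Finset (List Letter)) :
    ∑ w ∈ plainPerfect n, (if w ∈ S then (1 : ℝ) else 0) ≤ #S := by
  rw [sum_boole]
  exact_mod_cast card_le_card fun w hw => (mem_filter.1 hw).2

/-- Off the sparse sets all four counts exceed `(1 - η) n / 4`; as they sum to `n`, each is below `n
/ 4 + 3 η n / 4`. On a sparse set both compared numbers lie in `[0, 1]`, so the error is at most
`1`. -/
theorem abs_choose_div_sub_le {k n : ℕ} (hn : 0 < n) {η δ : ℝ} (hδ : 0 ≤ δ)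
    (h : ∀ x : ℕ, |(x : ℝ) - n / 4| ≤ η * n →
      |(x.choose k : ℝ) / n ^ k - 1 / (k.factorial * 4 ^ k)| ≤ δ)
    {w : List Letter} (hw : w ∈ plainPerfect n) :
    |((orderCount .cheese .cheese [] w).choose k : ℝ) / n ^ k - 1 / (k.factorial * 4 ^ k)| ≤
      δ + ((if w ∈ sparseWords ((1 - η) / 8) .ham .ham n then 1 else 0) +
        (if w ∈ sparseWords ((1 - η) / 8) .ham .cheese n then 1 else 0) +
        ((if w ∈ sparseWords ((1 - η) / 8) .cheese .ham n then 1 else 0) +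
        (if w ∈ sparseWords ((1 - η) / 8) .cheese .cheese n then 1 else 0))) := by
  have hsum := sum_orderCount_of_mem_plainPerfect hw
  have hn0 : (0 : ℝ) < n := by exact_mod_cast hn
  have hmem : ∀ b t, w ∉ sparseWords ((1 - η) / 8) b t n →
      (n : ℝ) / 4 - η * n / 4 < orderCount b t [] w := by
    intro b t h
    simp only [sparseWords, mem_filter, (mem_filter.1 hw).1, true_and, not_le] at h
    push_cast at h
    linarith
  have htriv : |((orderCount .cheese .cheese [] w).choose k : ℝ) / n ^ k -
      1 / (k.factorial * 4 ^ k)| ≤ 1 := by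
    have h1 : ((orderCount .cheese .cheese [] w).choose k : ℝ) / n ^ k ≤ 1 := by
      rw [div_le_one (by positivity)]
      have h2 : (orderCount .cheese .cheese [] w).choose k ≤ n ^ k :=
        (Nat.choose_le_pow _ _).trans (Nat.pow_le_pow_left (by omega) k)
      exact_mod_cast h2
    have h2 : (0 : ℝ) ≤ ((orderCount .cheese .cheese [] w).choose k : ℝ) / n ^ k := by positivity
    have h3 : (1 : ℝ) / (k.factorial * 4 ^ k) ≤ 1 := by
      refine div_le_one_of_le₀ ?_ (by positivity)
      have h4 : 1 ≤ k.factorial * 4 ^ k := Nat.mul_pos k.factorial_pos (by positivity)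
      exact_mod_cast h4
    have h4 : (0 : ℝ) ≤ 1 / (k.factorial * 4 ^ k) := by positivity
    rw [abs_le]
    constructor <;> linarith
  by_cases hgood : ∀ b t, w ∉ sparseWords ((1 - η) / 8) b t n
  · simp only [hgood, if_false, add_zero]
    refine h _ ?_
    have h1 := hmem _ _ (hgood .ham .ham)
    have h2 := hmem _ _ (hgood .ham .cheese)
    have h3 := hmem _ _ (hgood .cheese .ham)
    have h4 := hmem _ _ (hgood .cheese .cheese)
    have h5 : (orderCount .ham .ham [] w : ℝ) + orderCount .ham .cheese [] w +
      (orderCount .cheese .ham [] w + orderCount .cheese .cheese [] w) = n := by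
      exact_mod_cast hsum
    rw [abs_le]
    constructor <;> linarith
  · push Not at hgood
    obtain ⟨b, t, hbt⟩ := hgood
    refine htriv.trans ?_
    have hnonneg : ∀ b t, (0 : ℝ) ≤ if w ∈ sparseWords ((1 - η) / 8) b t n then 1 else 0 := by
      intro b t
      split_ifs <;> norm_num
    have h1 := hnonneg .ham .ham
    have h2 := hnonneg .ham .cheese
    have h3 := hnonneg .cheese .ham
    have h4 := hnonneg .cheese .cheese
    rcases b with _ | _ <;> rcases t with _ | _ <;> rw [if_pos hbt] <;> linarith

theorem card_plainPerfect_pos (n : ℕ) : 0 < #(plainPerfect n) :=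
  Nat.pos_of_ne_zero fun h => by simpa [h] using pow_le_card_plainPerfect n

theorem abs_sum_choose_div_sub_le {k n : ℕ} (hn : 0 < n) {η δ : ℝ} (hδ : 0 ≤ δ)
    (h : ∀ x : ℕ, |(x : ℝ) - n / 4| ≤ η * n →
      |(x.choose k : ℝ) / n ^ k - 1 / (k.factorial * 4 ^ k)| ≤ δ) :
    |(∑ w ∈ plainPerfect n, ((orderCount .cheese .cheese [] w).choose k : ℝ)) /
        (n ^ k * #(plainPerfect n)) - 1 / (k.factorial * 4 ^ k)| ≤
      δ + ((#(sparseWords ((1 - η) / 8) .ham .ham n) : ℝ) / #(plainPerfect n) +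
        (#(sparseWords ((1 - η) / 8) .ham .cheese n) : ℝ) / #(plainPerfect n) +
        ((#(sparseWords ((1 - η) / 8) .cheese .ham n) : ℝ) / #(plainPerfect n) +
        (#(sparseWords ((1 - η) / 8) .cheese .cheese n) : ℝ) / #(plainPerfect n))) := by
  have hpos : (0 : ℝ) < #(plainPerfect n) := by exact_mod_cast card_plainPerfect_pos n
  have hmean : (∑ w ∈ plainPerfect n, ((orderCount .cheese .cheese [] w).choose k : ℝ)) /
        (n ^ k * #(plainPerfect n)) - 1 / (k.factorial * 4 ^ k) =
      (∑ w ∈ plainPerfect n, (((orderCount .cheese .cheese [] w).choose k : ℝ) / n ^ k -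
        1 / (k.factorial * 4 ^ k))) / #(plainPerfect n) := by
    rw [sum_sub_distrib, sum_const, nsmul_eq_mul, sub_div, mul_div_cancel_left₀ _ hpos.ne',
      ← sum_div, div_div]
  rw [hmean, abs_div, abs_of_pos hpos, div_le_iff₀ hpos]
  refine (abs_sum_le_sum_abs _ _).trans
    ((sum_le_sum fun w hw => abs_choose_div_sub_le hn hδ h hw).trans ?_)
  simp only [sum_add_distrib, sum_const, nsmul_eq_mul]
  have hmul : ∀ x : ℝ, x / #(plainPerfect n) * #(plainPerfect n) = x :=
    fun x => div_mul_cancel₀ x hpos.ne'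
  rw [add_mul, add_mul, add_mul, add_mul, hmul, hmul, hmul, hmul, mul_comm]
  gcongr <;> exact sum_indicator_le n _

theorem tendsto_sum_choose_div (k : ℕ) :
    Filter.Tendsto (fun n : ℕ =>
      (∑ w ∈ plainPerfect n, ((orderCount .cheese .cheese [] w).choose k : ℝ)) /
        ((n : ℝ) ^ k * (plainPerfect n).card))
      Filter.atTop (nhds (1 / ((k.factorial : ℝ) * 4 ^ k))) := by
  rw [Metric.tendsto_atTop]
  intro ε hε
  obtain ⟨η, hη, hη1, N, hN⟩ := exists_abs_choose_div_sub_le k (half_pos hε)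
  have hlim := fun b t => tendsto_card_sparseWords_div b t (μ := (1 - η) / 8)
    (by linarith) (by linarith)
  have hsum := ((hlim .ham .ham).add (hlim .ham .cheese)).add
    ((hlim .cheese .ham).add (hlim .cheese .cheese))
  simp only [add_zero] at hsum
  obtain ⟨M, hM⟩ := Filter.eventually_atTop.1 (hsum.eventually_lt_const (half_pos hε))
  refine ⟨max (N + 1) M, fun n hn => ?_⟩
  have h1 : N + 1 ≤ n := (le_max_left _ _).trans hn
  have h2 := hM n ((le_max_right _ _).trans hn)
  rw [Real.dist_eq]
  refine (abs_sum_choose_div_sub_le (by omega) (half_pos hε).le (hN n (by omega))).trans_lt ?_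
  linarith

end HamburgerCheeseburger

theorem theorem4p1 (k : ℕ) :
    Filter.Tendsto
      (fun n : ℕ =>
        ((HamburgerCheeseburger.Theta k n).ncard : ℝ) /
          ((n : ℝ) ^ k * ((HamburgerCheeseburger.Theta 0 n).ncard : ℝ)))
      Filter.atTop (nhds (1 / ((k.factorial : ℝ) * 4 ^ k))) := by
  simp only [HamburgerCheeseburger.ncard_Theta_zero]
  simpa only [HamburgerCheeseburger.ncard_Theta, Nat.cast_sum] using
    HamburgerCheeseburger.tendsto_sum_choose_div k
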